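/- Let $R$ be a finite, reduced, crystallographic root system spanning the real vector space $\mathbb{R}R$, with automorphism group $A=\operatorname{Aut}(R)$ (the linear automorphisms of $\mathbb{R}R$ that map $R$ onto itself). For a system $\Delta$ of simple roots of $R$ and a subset $\Theta\subseteq\Delta$, let $W_\Theta=\langle s_\alpha : \alpha\in\Theta\rangle$ be the subgroup of $A$ generated by the reflections in the roots in $\Theta$, let $\operatorname{Aut}(R,\Delta)$ be the setwise stabilizer of $\Delta$ in $A$, and put $$A_{\Theta\subseteq\Delta}=W_\Theta\rtimes\operatorname{Stab}_{\operatorname{Aut}(R,\Delta)}(\Theta),$$ where $\operatorname{Stab}$ denotes the setwise stabilizer. A subgroup of $A$ is called parabolic if it has the form $A_{\Theta\subseteq\Delta}$ for some system $\Delta$ of simple roots of $R$ and some $\Theta\subseteq\Delta$, and an element of $A$ is called elliptic if it belongs to no proper parabolic subgroup of $A$. Then an element $w\in A$ is elliptic if and only if it has no nonzero fixed vector in $\mathbb{R}R$. -/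

import Mathlib

open scoped Pointwise

namespace RootPairing

variable {ι R M N : Type*} [CommRing R] [AddCommGroup M] [Module R M] [AddCommGroup N] [Module R N]

/-- For a set `I` of (indices of) roots, the subgroup `W_I` of the automorphism group of a root
system generated by the reflections in the roots belonging to `I`. -/
noncomputable def reflectionSubgroup (P : RootPairing ι R M N) (I : Set ι) : Subgroup P.Aut :=
  Subgroup.closure (Equiv.reflection P '' I)

/-- For a system `b` of simple roots and a set `I` of roots, the setwise stabiliser of `I` in
`Aut(P, b)`, where `Aut(P, b)` is the setwise stabiliser of `b` in the automorphism group. -/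
noncomputable def simpleStabilizer {P : RootPairing ι R M N} (b : P.Base) (I : Set ι) : Subgroup P.Aut :=
  MulAction.stabilizer P.Aut (b.support : Set ι) ⊓ MulAction.stabilizer P.Aut I

/-- The group `A_{I ⊆ b} = W_I ⋊ stab_{Aut(P, b)}(I)`: since the second factor normalises the
first, the subgroup generated by the two factors is the set of their products, see
`mem_parabolicSubgroup_iff`. -/
noncomputable def parabolicSubgroup {P : RootPairing ι R M N} (b : P.Base) (I : Set ι) : Subgroup P.Aut :=
  P.reflectionSubgroup I ⊔ simpleStabilizer b I

/-- A subgroup of the automorphism group of a root system is parabolic if it is of the form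
`A_{I ⊆ b}` for some system `b` of simple roots and some subset `I` of `b`. -/
def IsParabolic (P : RootPairing ι R M N) (Q : Subgroup P.Aut) : Prop :=
  ∃ (b : P.Base) (I : Set ι), I ⊆ (b.support : Set ι) ∧ Q = parabolicSubgroup b I

/-- An automorphism of a root system is elliptic if it belongs to no proper parabolic subgroup of
the automorphism group. -/
def IsElliptic (P : RootPairing ι R M N) (w : P.Aut) : Prop :=
  ∀ Q : Subgroup P.Aut, P.IsParabolic Q → Q ≠ ⊤ → w ∉ Q

theorem conj_reflection (P : RootPairing ι R M N) (g : P.Aut) (i : ι) :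
    g * Equiv.reflection P i * g⁻¹ = Equiv.reflection P (g • i) := by
  apply Equiv.weightHom_injective P
  ext x
  change g • (Equiv.reflection P i • (g⁻¹ • x)) = Equiv.reflection P (g • i) • x
  obtain ⟨y, rfl⟩ : ∃ y, x = g • y := ⟨g⁻¹ • x, by simp⟩
  have h : P.toLinearMap (g • y) (P.coroot (g • i)) = P.toLinearMap y (P.coroot i) := by
    have h1 := LinearMap.congr_fun
      (Hom.weight_coweight_transpose_apply P P (P.coroot (g • i)) g.toHom) y
    rw [Hom.coroot_coweightMap_apply] at h1
    have h2 : g.toHom.indexEquiv.symm (g • i) = i := g.toHom.indexEquiv.symm_apply_apply i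
    rw [h2] at h1
    exact h1
  have hr : P.root (g • i) = g • P.root i := Equiv.root_indexEquiv_eq_smul (P := P) i g
  rw [inv_smul_smul, Equiv.reflection_smul, Equiv.reflection_smul, reflection_apply,
    reflection_apply, smul_sub, smul_comm g, ← hr]
  congr 2
  exact h.symm

theorem simpleStabilizer_le_normalizer {P : RootPairing ι R M N} (b : P.Base) (I : Set ι) :
    simpleStabilizer b I ≤ Subgroup.normalizer (P.reflectionSubgroup I : Set P.Aut) := by
  intro g hg
  have hI : g • I = I := hg.2
  rw [Subgroup.mem_normalizer_iff_map_conj_eq, reflectionSubgroup, MonoidHom.map_closure]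
  congr 1
  conv_rhs => rw [← hI]
  rw [← Set.image_smul, Set.image_image, Set.image_image]
  exact Set.image_congr fun i _ ↦ conj_reflection P g i

theorem mem_parabolicSubgroup_iff {P : RootPairing ι R M N} (b : P.Base) (I : Set ι) (w : P.Aut) :
    w ∈ parabolicSubgroup b I ↔
      ∃ u ∈ P.reflectionSubgroup I, ∃ v ∈ simpleStabilizer b I, u * v = w := by
  rw [← SetLike.mem_coe, parabolicSubgroup,
    Subgroup.coe_mul_of_right_le_normalizer_left _ _ (simpleStabilizer_le_normalizer b I)]
  rfl

end RootPairing

namespace RootPairing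

variable {ι M N : Type*} [AddCommGroup M] [Module ℝ M] [AddCommGroup N] [Module ℝ N]
  {P : RootPairing ι ℝ M N}

/-! Ellipticity reduces to fixed vectors because proper parabolics and stabilizers of nonzero
vectors dominate each other. A vector `x` is dominant for some base; if `g` fixes `x`, simple
reflections orthogonal to `x` carry `g` into the stabilizer of the base, so `g` lies in the
parabolic of the simple roots orthogonal to `x` (`mem_parabolicSubgroup_of_smul_eq_self`), which is
proper when `x ≠ 0`. Conversely, the parabolic of a proper subset `I` fixes the sum of the
fundamental weights outside `I` (`exists_ne_zero_forall_smul_eq_self`). -/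

lemma root_smul (g : P.Aut) (i : ι) : P.root (g • i) = g • P.root i :=
  Equiv.root_indexEquiv_eq_smul (P := P) i g

lemma reflection_smul_index (i j : ι) : Equiv.reflection P i • j = P.reflectionPerm i j := rfl

/-- Automorphisms of a root pairing preserve the pairing of weights with coroots. -/
lemma toLinearMap_smul_coroot_smul (g : P.Aut) (x : M) (i : ι) :
    P.toLinearMap (g • x) (P.coroot (g • i)) = P.toLinearMap x (P.coroot i) := by
  have h := LinearMap.congr_fun
    (Hom.weight_coweight_transpose_apply P P (P.coroot (g • i)) g.toHom) x
  rw [Hom.coroot_coweightMap_apply] at h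
  have h' : g.toHom.indexEquiv.symm (g • i) = i := g.toHom.indexEquiv.symm_apply_apply i
  rw [h'] at h
  exact h

lemma toLinearMap_smul_coroot (g : P.Aut) (x : M) (i : ι) :
    P.toLinearMap (g • x) (P.coroot i) = P.toLinearMap x (P.coroot (g⁻¹ • i)) := by
  rw [← toLinearMap_smul_coroot_smul g x, smul_inv_smul]

lemma reflection_smul_eq_self_iff (i : ι) (x : M) :
    Equiv.reflection P i • x = x ↔ P.toLinearMap x (P.coroot i) = 0 := by
  simp [reflection_apply, P.ne_zero i]

/-! ### Bases and their images -/

namespace Base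

/-- The image of a base under an automorphism. -/
noncomputable def map [Finite ι] [P.IsRootSystem] [P.IsCrystallographic] [P.IsReduced]
    (b : P.Base) (g : P.Aut) : P.Base :=
  have himage : P.root '' (g • (b.support : Set ι)) =
      Equiv.weightHom P g '' (P.root '' (b.support : Set ι)) := by
    rw [← Set.image_smul, Set.image_image, Set.image_image]
    exact Set.image_congr fun i _ ↦ root_smul g i
  have hmem (i : ι) (h : P.root i ∈ AddSubmonoid.closure (P.root '' (b.support : Set ι))) :
      P.root (g • i) ∈ AddSubmonoid.closure (P.root '' (g • (b.support : Set ι))) := by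
    rw [himage, root_smul]
    have := AddSubmonoid.mem_map_of_mem (Equiv.weightHom P g : M →+ M) h
    rwa [AddMonoidHom.map_mclosure] at this
  have hneg (i : ι) (h : -P.root i ∈ AddSubmonoid.closure (P.root '' (b.support : Set ι))) :
      -P.root (g • i) ∈ AddSubmonoid.closure (P.root '' (g • (b.support : Set ι))) := by
    rw [himage, root_smul, ← smul_neg]
    have := AddSubmonoid.mem_map_of_mem (Equiv.weightHom P g : M →+ M) h
    rwa [AddMonoidHom.map_mclosure] at this
  Base.mk' P (g • (b.support : Set ι))
    (by
      rw [linearIndepOn_iff_image P.root.injective.injOn, himage,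
        ← linearIndepOn_iff_image (Equiv.weightHom P g).injective.injOn]
      have h := b.linearIndepOn_root.id_image.linearIndependent
      exact h.map' (Equiv.weightHom P g).toLinearMap (LinearEquiv.ker _))
    (fun i ↦ by
      rw [← smul_inv_smul g i]
      exact (b.root_mem_or_neg_mem (g⁻¹ • i)).imp (hmem _) (hneg _))

@[simp] lemma coe_support_map [Finite ι] [P.IsRootSystem] [P.IsCrystallographic] [P.IsReduced]
    (b : P.Base) (g : P.Aut) : ((b.map g).support : Set ι) = g • (b.support : Set ι) := by
  simp [map, Base.mk']

variable {b : P.Base}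

lemma isPos_reflectionPerm_self_iff {i : ι} : b.IsPos (P.reflectionPerm i i) ↔ ¬ b.IsPos i :=
  IsPos.neg_iff_not b i

/-- The simple coroots form a basis of `N`, and the pairing is perfect. -/
lemma ext_coroot [P.IsRootSystem] {x y : M}
    (h : ∀ i ∈ b.support, P.toLinearMap x (P.coroot i) = P.toLinearMap y (P.coroot i)) :
    x = y := by
  apply P.toPerfPair.injective
  refine b.toCoweightBasis.ext fun i ↦ ?_
  simpa using h i i.2

variable (b) in
/-- A weight with prescribed pairings with the simple coroots. -/
lemma exists_toLinearMap_coroot_eq [P.IsRootSystem] (c : ι → ℝ) :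
    ∃ x : M, ∀ i ∈ b.support, P.toLinearMap x (P.coroot i) = c i := by
  refine ⟨P.toPerfPair.symm (b.toCoweightBasis.constr ℝ fun i ↦ c i), fun i hi ↦ ?_⟩
  have := b.toCoweightBasis.constr_basis ℝ (fun i ↦ c i) ⟨i, hi⟩
  rw [toCoweightBasis_apply] at this
  rw [← this, ← P.toPerfPair_apply, LinearEquiv.apply_symm_apply]

/-! ### Positive roots -/

section Finite

variable [Finite ι] [P.IsCrystallographic]

/-- A positive root which is not simple is a sum of two positive roots. -/
lemma IsPos.mem_support_or_exists_add {i : ι} (hi : b.IsPos i) :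
    i ∈ b.support ∨ ∃ j k, b.IsPos j ∧ b.IsPos k ∧ P.root i = P.root j + P.root k := by
  suffices b.IsPos i ∧
      (i ∈ b.support ∨ ∃ j k, b.IsPos j ∧ b.IsPos k ∧ P.root i = P.root j + P.root k) from this.2
  refine hi.induction_on_add (p := fun i ↦ b.IsPos i ∧
    (i ∈ b.support ∨ ∃ j k, b.IsPos j ∧ b.IsPos k ∧ P.root i = P.root j + P.root k)) (fun j hj ↦ ⟨isPos_of_mem_support hj, Or.inl hj⟩) ?_
  intro j k l h hj hk
  exact ⟨hj.1.add (isPos_of_mem_support hk) h,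
    Or.inr ⟨j, k, hj.1, isPos_of_mem_support hk, h⟩⟩

lemma IsPos.smul {g : P.Aut} (h : ∀ i ∈ b.support, b.IsPos (g • i)) {i : ι} (hi : b.IsPos i) :
    b.IsPos (g • i) := by
  refine hi.induction_on_add h fun j k l hl hj hk ↦ hj.add (h k hk) ?_
  rw [root_smul, root_smul, root_smul, hl, smul_add]

/-- An automorphism sending simple roots to positive roots stabilizes the base. -/
lemma mem_stabilizer_of_forall_isPos {g : P.Aut} (h : ∀ i ∈ b.support, b.IsPos (g • i)) :
    g ∈ MulAction.stabilizer P.Aut (b.support : Set ι) := by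
  have hg : g • {i | b.IsPos i} = {i | b.IsPos i} := by
    refine Set.eq_of_subset_of_ncard_le ?_ (Set.ncard_smul_set _ _).ge (Set.toFinite _)
    rintro - ⟨i, hi, rfl⟩
    exact hi.smul h
  have hinv {i : ι} (hi : b.IsPos i) : b.IsPos (g⁻¹ • i) := by
    have : i ∈ g • {i | b.IsPos i} := by rwa [hg]
    rwa [Set.mem_smul_set_iff_inv_smul_mem] at this
  refine Set.eq_of_subset_of_ncard_le ?_ (Set.ncard_smul_set _ _).ge (Set.toFinite _)
  rintro - ⟨i, hi, rfl⟩
  refine (h i hi).mem_support_or_exists_add.resolve_right ?_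
  -- Applying `g⁻¹`, which preserves positivity, would split a simple root, of height 1, into two
  -- positive roots.
  rintro ⟨j, k, hj, hk, hjk⟩
  have hsum : P.root i = P.root (g⁻¹ • j) + P.root (g⁻¹ • k) := by
    rw [root_smul, root_smul, ← smul_add, ← hjk]
    simp [root_smul]
  have h₁ := b.height_add hsum
  have h₂ := b.height_one_of_mem_support hi
  have h₃ : 0 < b.height (g⁻¹ • j) := hinv hj
  have h₄ : 0 < b.height (g⁻¹ • k) := hinv hk
  lia

/-- A dominant weight pairs nonnegatively with all positive coroots. -/
lemma IsPos.toLinearMap_coroot_nonneg [P.IsRootSystem] {x : M}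
    (hx : ∀ i ∈ b.support, 0 ≤ P.toLinearMap x (P.coroot i)) {i : ι} (hi : b.IsPos i) :
    0 ≤ P.toLinearMap x (P.coroot i) := by
  have : Fintype ι := Fintype.ofFinite ι
  -- Coroots are not additive in roots; pairing by `RootForm` has the same sign and is.
  have hform (j : ι) : 0 ≤ P.toLinearMap x (P.coroot j) ↔ 0 ≤ P.RootForm x (P.root j) := by
    have hpos : 0 < 2 / P.RootForm (P.root j) (P.root j) := by
      have h₁ := P.zero_le_rootForm (P.root j)
      have h₂ : P.RootForm (P.root j) (P.root j) ≠ 0 :=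
        IsAnisotropic.rootForm_root_ne_zero (P := P) j
      have := h₁.lt_of_ne' h₂
      positivity
    have heq : P.toLinearMap x (P.PolarizationEquiv (P.root j)) = P.RootForm x (P.root j) := by
      rw [polarizationEquiv_apply, ← P.rootForm_symmetric.eq, RingHom.id_apply,
        ← P.flip_comp_polarization_eq_rootForm]
      rfl
    rw [coroot_eq_polarizationEquiv_apply_root, map_smul, smul_eq_mul, heq,
      mul_nonneg_iff_of_pos_left hpos]
  rw [hform]
  refine hi.induction_on_add (fun j hj ↦ (hform j).mp (hx j hj)) ?_
  intro j k l hl hj hk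
  rw [hl, map_add]
  exact add_nonneg hj ((hform k).mp (hx k hk))

/-! ### Descent by simple reflections -/

variable [P.IsReduced]

/-- Reflecting in a simple root `i` reduces the number of positive roots in a set which contains
`i` but not `-i`. -/
lemma ncard_isPos_reflectionPerm_lt {S : Set ι} {i : ι} (hi : i ∈ b.support) (hS : i ∈ S)
    (hS' : P.reflectionPerm i i ∉ S) :
    {j | b.IsPos j ∧ P.reflectionPerm i j ∈ S}.ncard < {j | b.IsPos j ∧ j ∈ S}.ncard := by
  rw [← Set.ncard_image_of_injective _ (P.reflectionPerm i).injective]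
  refine Set.ncard_lt_ncard ⟨?_, fun h ↦ ?_⟩ (Set.toFinite _)
  · rintro - ⟨j, ⟨hj, hjS⟩, rfl⟩
    exact ⟨hj.reflectionPerm hi fun hji ↦ hS' (hji ▸ hjS), hjS⟩
  · obtain ⟨j, ⟨hj, -⟩, hji⟩ := h (a := i) ⟨isPos_of_mem_support hi, hS⟩
    have : j = P.reflectionPerm i i := by
      rw [← (P.reflectionPerm i).injective.eq_iff, hji]
      simp
    exact isPos_reflectionPerm_self_iff.mp (this ▸ hj) (isPos_of_mem_support hi)

variable (b) in
/-- Every weight is conjugate to a dominant one. -/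
lemma exists_smul_dominant (x : M) :
    ∃ g : P.Aut, ∀ i ∈ b.support, 0 ≤ P.toLinearMap (g • x) (P.coroot i) := by
  -- Induct on the number of positive coroots negative on `x`.
  generalize hn : {j | b.IsPos j ∧ j ∈ {j | P.toLinearMap x (P.coroot j) < 0}}.ncard = n
  induction n using Nat.strong_induction_on generalizing x with
  | _ n ih =>
    by_cases h : ∀ i ∈ b.support, 0 ≤ P.toLinearMap x (P.coroot i)
    · exact ⟨1, by simpa using h⟩
    push Not at h
    obtain ⟨i, hi, hix⟩ := h
    have hlt := ncard_isPos_reflectionPerm_lt (S := {j | P.toLinearMap x (P.coroot j) < 0})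
      hi hix (by simpa using hix.le)
    have hS (j : ι) : P.toLinearMap (Equiv.reflection P i • x) (P.coroot j) =
        P.toLinearMap x (P.coroot (P.reflectionPerm i j)) := by
      rw [toLinearMap_smul_coroot, Equiv.reflection_inv, reflection_smul_index]
    obtain ⟨g, hg⟩ := ih _ (hn ▸ hlt) (Equiv.reflection P i • x) (by simp only [hS, Set.mem_ofPred_eq])
    exact ⟨g * Equiv.reflection P i, by simpa only [mul_smul] using hg⟩

variable [P.IsRootSystem]

/-- If an automorphism fixes a dominant weight `x`, then some product with reflections in
simple roots orthogonal to `x` stabilizes the base. -/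
lemma exists_mul_mem_stabilizer {x : M}
    (hx : ∀ i ∈ b.support, 0 ≤ P.toLinearMap x (P.coroot i)) (g : P.Aut) (hg : g • x = x) :
    ∃ u ∈ P.reflectionSubgroup {i | i ∈ b.support ∧ P.toLinearMap x (P.coroot i) = 0},
      u * g ∈ MulAction.stabilizer P.Aut (b.support : Set ι) := by
  -- Induct on the number of positive roots that `g⁻¹` makes negative.
  generalize hn : {j | b.IsPos j ∧ j ∈ {j | ¬ b.IsPos (g⁻¹ • j)}}.ncard = n
  induction n using Nat.strong_induction_on generalizing g with
  | _ n ih =>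
    by_cases h : ∀ i ∈ b.support, b.IsPos (g⁻¹ • i)
    · refine ⟨1, one_mem _, ?_⟩
      rw [one_mul, ← inv_mem_iff]
      exact mem_stabilizer_of_forall_isPos h
    push Not at h
    obtain ⟨i, hi, hig⟩ := h
    have hneg : g⁻¹ • P.reflectionPerm i i =
        P.reflectionPerm (g⁻¹ • i) (g⁻¹ • i) := by
      apply P.root.injective
      have h : P.reflectionPerm (g⁻¹ • i) (g⁻¹ • i) = Equiv.reflection P (g⁻¹ • i) • g⁻¹ • i := rfl
      rw [h, ← conj_reflection]
      simp only [mul_smul, smul_inv_smul, inv_inv, reflection_smul_index]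
    have hpos : b.IsPos (g⁻¹ • P.reflectionPerm i i) := by
      rwa [hneg, isPos_reflectionPerm_self_iff]
    -- As `g` fixes `x`, the coroot of `-i` pairs with `x` as that of the positive root `g⁻¹ • (-i)`
    -- does: nonnegatively.
    have hix : P.toLinearMap x (P.coroot i) = 0 := by
      refine le_antisymm ?_ (hx i hi)
      have := hpos.toLinearMap_coroot_nonneg hx
      rw [← toLinearMap_smul_coroot, hg] at this
      simpa using this
    have hlt := ncard_isPos_reflectionPerm_lt (S := {j | ¬ b.IsPos (g⁻¹ • j)}) hi hig
      (by simpa using hpos)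
    have hfix : Equiv.reflection P i • x = x := (reflection_smul_eq_self_iff i x).mpr hix
    obtain ⟨u, hu, hug⟩ := ih _ (hn ▸ hlt) (Equiv.reflection P i * g)
      (by rw [mul_smul, hg, hfix])
      (by simp only [mul_inv_rev, Equiv.reflection_inv, mul_smul, reflection_smul_index,
            Set.mem_ofPred_eq])
    refine ⟨u * Equiv.reflection P i, mul_mem hu ?_, by rwa [mul_assoc]⟩
    exact Subgroup.subset_closure (Set.mem_image_of_mem _ ⟨hi, hix⟩)

end Finite

end Base

/-! ### Parabolic subgroups and fixed weights -/

lemma smul_eq_self_of_mem_reflectionSubgroup {I : Set ι} {x : M}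
    (hx : ∀ i ∈ I, P.toLinearMap x (P.coroot i) = 0) {u : P.Aut}
    (hu : u ∈ P.reflectionSubgroup I) : u • x = x := by
  suffices P.reflectionSubgroup I ≤ MulAction.stabilizer P.Aut x from this hu
  rw [reflectionSubgroup, Subgroup.closure_le]
  rintro - ⟨i, hi, rfl⟩
  exact (reflection_smul_eq_self_iff i x).mpr (hx i hi)

/-- The stabilizer of a dominant weight is contained in the parabolic subgroup given by the simple
roots orthogonal to it. -/
lemma mem_parabolicSubgroup_of_smul_eq_self [Finite ι] [P.IsRootSystem] [P.IsCrystallographic]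
    [P.IsReduced] {b : P.Base} {x : M}
    (hx : ∀ i ∈ b.support, 0 ≤ P.toLinearMap x (P.coroot i)) {g : P.Aut} (hg : g • x = x) :
    g ∈ parabolicSubgroup b {i | i ∈ b.support ∧ P.toLinearMap x (P.coroot i) = 0} := by
  obtain ⟨u, hu, hug⟩ := b.exists_mul_mem_stabilizer hx g hg
  rw [mem_parabolicSubgroup_iff]
  refine ⟨u⁻¹, inv_mem hu, u * g, ⟨hug, ?_⟩, inv_mul_cancel_left u g⟩
  have hfix : (u * g) • x = x := by
    rw [mul_smul, hg, smul_eq_self_of_mem_reflectionSubgroup (fun i hi ↦ hi.2) hu]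
  have hinter : {i | i ∈ b.support ∧ P.toLinearMap x (P.coroot i) = 0} =
      (b.support : Set ι) ∩ {i | P.toLinearMap x (P.coroot i) = 0} := rfl
  have hstab : (u * g) • {i | P.toLinearMap x (P.coroot i) = 0} =
      {i | P.toLinearMap x (P.coroot i) = 0} := by
    ext i
    rw [Set.mem_smul_set_iff_inv_smul_mem, Set.mem_ofPred_eq, Set.mem_ofPred_eq,
      ← toLinearMap_smul_coroot, hfix]
  change (u * g) • _ = _
  rw [hinter, Set.smul_set_inter,
    MulAction.mem_stabilizer_iff.mp hug, hstab]

lemma parabolicSubgroup_support [Finite ι] [P.IsRootSystem] [P.IsCrystallographic] [P.IsReduced]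
    (b : P.Base) : parabolicSubgroup b (b.support : Set ι) = ⊤ := by
  refine eq_top_iff.mpr fun g _ ↦ ?_
  simpa using mem_parabolicSubgroup_of_smul_eq_self (b := b) (x := 0) (by simp) (smul_zero g)

/-- The parabolic subgroup given by a proper subset of a base fixes a nonzero weight. -/
lemma exists_ne_zero_forall_smul_eq_self [P.IsRootSystem] {b : P.Base} {I : Set ι}
    (hI : I ⊆ b.support) (hI' : I ≠ b.support) :
    ∃ x : M, x ≠ 0 ∧ ∀ g ∈ parabolicSubgroup b I, g • x = x := by
  classical
  obtain ⟨x, hx⟩ := b.exists_toLinearMap_coroot_eq fun i ↦ if i ∈ I then 0 else 1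
  refine ⟨x, ?_, fun g hg ↦ ?_⟩
  · rintro rfl
    obtain ⟨i, hi, hiI⟩ := Set.exists_of_ssubset (hI.ssubset_of_ne hI')
    simpa [hiI] using hx i hi
  · obtain ⟨u, hu, v, ⟨hv, hvI⟩, rfl⟩ := (mem_parabolicSubgroup_iff b I g).mp hg
    have hvx : v • x = x := by
      refine b.ext_coroot fun i hi ↦ ?_
      have hi' : v⁻¹ • i ∈ b.support := by
        rw [← Finset.mem_coe, ← Set.mem_smul_set_iff_inv_smul_mem,
          MulAction.mem_stabilizer_iff.mp hv]
        exact hi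
      have hiI : v⁻¹ • i ∈ I ↔ i ∈ I := by
        rw [← Set.mem_smul_set_iff_inv_smul_mem, MulAction.mem_stabilizer_iff.mp hvI]
      rw [toLinearMap_smul_coroot, hx _ hi', hx i hi, if_congr hiI rfl rfl]
    rw [mul_smul, hvx]
    exact smul_eq_self_of_mem_reflectionSubgroup (fun i hi ↦ by simpa [hi] using hx i (hI hi)) hu

/-- No nonzero weight is fixed by every reflection. -/
lemma parabolicSubgroup_ne_top [P.IsRootSystem] {b : P.Base} {I : Set ι}
    (hI : I ⊆ b.support) (hI' : I ≠ b.support) : parabolicSubgroup b I ≠ ⊤ := by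
  obtain ⟨x, hx, hfix⟩ := exists_ne_zero_forall_smul_eq_self hI hI'
  intro htop
  refine hx (b.ext_coroot fun i _ ↦ ?_)
  rw [(reflection_smul_eq_self_iff i x).mp (hfix _ (htop ▸ Subgroup.mem_top _))]
  simp

end RootPairing

theorem mainTheorem8 {ι M N : Type*} [Finite ι]
    [AddCommGroup M] [Module ℝ M] [AddCommGroup N] [Module ℝ N]
    (P : RootPairing ι ℝ M N) [P.IsRootSystem] [P.IsCrystallographic] [P.IsReduced]
    (w : P.Aut) :
    P.IsElliptic w ↔ ¬ ∃ x ∈ Submodule.span ℝ (Set.range P.root), x ≠ 0 ∧ w • x = x := by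
  open RootPairing in
  constructor
  · rintro hw ⟨x, -, hx₀, hwx⟩
    obtain ⟨b₀⟩ := P.nonempty_base
    obtain ⟨g, hg⟩ := b₀.exists_smul_dominant x
    -- Move the base instead of `x`, so that `w` need not be conjugated.
    let b := b₀.map g⁻¹
    have hx : ∀ i ∈ b.support, 0 ≤ P.toLinearMap x (P.coroot i) := by
      intro i hi
      rw [← Finset.mem_coe, Base.coe_support_map, Set.mem_smul_set_iff_inv_smul_mem, inv_inv] at hi
      rw [← toLinearMap_smul_coroot_smul g]
      exact hg _ hi
    refine hw _ ⟨b, _, fun i hi ↦ hi.1, rfl⟩ (parabolicSubgroup_ne_top (fun i hi ↦ hi.1) ?_)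
      (mem_parabolicSubgroup_of_smul_eq_self hx hwx)
    intro heq
    refine hx₀ (b.ext_coroot fun i hi ↦ ?_)
    rw [← Finset.mem_coe, ← heq] at hi
    rw [hi.2]
    simp
  · rintro hw - ⟨b, I, hI, rfl⟩ hne hwI
    have hI' : I ≠ b.support := by
      rintro rfl
      exact hne (parabolicSubgroup_support b)
    obtain ⟨x, hx, hfix⟩ := exists_ne_zero_forall_smul_eq_self hI hI'
    refine hw ⟨x, ?_, hx, hfix w hwI⟩
    rw [IsRootSystem.span_root_eq_top]
    exact Submodule.mem_top
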